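/- Let $A$ be a complex $N\times N$ matrix whose spectrum does not meet the imaginary axis. Let $\mu_1,\dots,\mu_k$ be the roots of its characteristic polynomial in the open right half-plane and $\nu_1,\dots,\nu_m$ those in the open left half-plane, both counted with multiplicity (so $k+m=N$), and let $\gamma^+,\gamma^->0$ be real numbers with $$\operatorname{Re}\mu_i\ge\gamma^+\ (1\le i\le k),\qquad \operatorname{Re}\nu_j\le-\gamma^-\ (1\le j\le m).$$ Put $\gamma=\gamma^-+\gamma^+$. For $t\ne0$ and $\operatorname{Re}\lambda\neq0$ let $g_t(\lambda)$ be defined as follows: for $t>0$, $g_t(\lambda)=e^{\lambda t}$ if $\operatorname{Re}\lambda<0$ and $g_t(\lambda)=0$ if $\operatorname{Re}\lambda>0$; for $t<0$, $g_t(\lambda)=0$ if $\operatorname{Re}\lambda<0$ and $g_t(\lambda)=-e^{\lambda t}$ if $\operatorname{Re}\lambda>0$. Green's function of the bounded solutions problem for $x'(t)=Ax(t)+f(t)$, $t\in\mathbb R$, is $$\mathcal G(t)=g_t(A)=\frac1{2\pi i}\int_\Gamma g_t(\lambda)(\lambda\mathbf 1-A)^{-1}\,d\lambda,\qquad t\neq0,$$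 where $\Gamma\subset\mathbb C\setminus i\mathbb R$ is a contour that surrounds the spectrum of $A$ within $\mathbb C\setminus i\mathbb R$. Fix any norm on $\mathbb C^N$ and let $\|\cdot\|$ denote the induced operator norm on $N\times N$ matrices. Then $$\|\mathcal G(t)\|\le e^{-\gamma^-t}\sum_{j=0}^{m-1}\sum_{i=0}^{j}\frac{t^{j-i}}{(j-i)!}\binom{k+i-1}{k-1}\frac{(2\|A\|)^{k+j}}{\gamma^{k+i}},\qquad t>0,$$ $$\|\mathcal G(t)\|\le e^{\gamma^+t}\sum_{j=0}^{k-1}\sum_{i=0}^{j}\frac{|t|^{j-i}}{(j-i)!}\binom{m+i-1}{m-1}\frac{(2\|A\|)^{m+j}}{\gamma^{m+i}},\qquad t<0,$$ where for $k=0$ (respectively $m=0$) the binomial coefficient $\binom{k+i-1}{k-1}$ (respectively $\binom{m+i-1}{m-1}$) is read as $1$ if $i=0$ and as $0$ if $i\ge1$; empty sums are $0$. -/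

import Mathlib

open scoped Matrix

noncomputable section

namespace GreenEstimate

/-- A contour made of finitely many positively oriented circles; a circle is stored as the pair
(centre, radius). It lies in `U` and surrounds `K`: the closed discs lie in `U`, are pairwise
disjoint, and the open discs cover `K`. In particular no circle meets `K`, and the contour winds
exactly once around each point of `K` and not at all around points outside `U`. -/
structure IsContourAround (U K : Set ℂ) (Γ : Finset (ℂ × ℝ)) : Prop where
  radius_pos : ∀ d ∈ Γ, 0 < d.2
  disc_subset : ∀ d ∈ Γ, Metric.closedBall d.1 d.2 ⊆ U
  disjoint_discs : ∀ d ∈ Γ, ∀ d' ∈ Γ, d ≠ d' →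
    Disjoint (Metric.closedBall d.1 d.2) (Metric.closedBall d'.1 d'.2)
  surrounds : ∀ z ∈ K, ∃ d ∈ Γ, z ∈ Metric.ball d.1 d.2

theorem exists_contour (U K : Set ℂ) (hU : IsOpen U) (hK : K.Finite) (hKU : K ⊆ U) :
    ∃ Γ : Finset (ℂ × ℝ), IsContourAround U K Γ := by
  classical
  have h1 : ∀ᶠ r : ℝ in nhdsWithin 0 (Set.Ioi 0),
      ∀ z ∈ K, Metric.closedBall z r ⊆ U := by
    rw [Filter.eventually_all_finite hK]
    intro z hz
    obtain ⟨ε, hε, h⟩ := Metric.nhds_basis_closedBall.mem_iff.1 (hU.mem_nhds (hKU hz))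
    filter_upwards [Ioo_mem_nhdsGT hε] with r hr
    exact (Metric.closedBall_subset_closedBall hr.2.le).trans h
  have h2 : ∀ᶠ r : ℝ in nhdsWithin 0 (Set.Ioi 0),
      ∀ z ∈ K, ∀ w ∈ K, z ≠ w → r + r < dist z w := by
    rw [Filter.eventually_all_finite hK]
    intro z _
    rw [Filter.eventually_all_finite hK]
    intro w _
    by_cases hzw : z = w
    · simp [hzw]
    · have hd : 0 < dist z w / 2 := by have := dist_pos.2 hzw; positivity
      filter_upwards [Ioo_mem_nhdsGT hd] with r hr _
      linarith [hr.2]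
  obtain ⟨r, ⟨hr1, hr2⟩, hr⟩ := ((h1.and h2).and self_mem_nhdsWithin).exists
  have hr0 : 0 < r := hr
  refine ⟨hK.toFinset.image (fun z => (z, r)), ?_, ?_, ?_, ?_⟩
  · intro d hd
    simp only [Finset.mem_image] at hd
    obtain ⟨z, _, rfl⟩ := hd
    exact hr0
  · intro d hd
    simp only [Finset.mem_image, Set.Finite.mem_toFinset] at hd
    obtain ⟨z, hz, rfl⟩ := hd
    exact hr1 z hz
  · intro d hd d' hd' hne
    simp only [Finset.mem_image, Set.Finite.mem_toFinset] at hd hd'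
    obtain ⟨z, hz, rfl⟩ := hd
    obtain ⟨w, hw, rfl⟩ := hd'
    refine Metric.closedBall_disjoint_closedBall (hr2 z hz w hw ?_)
    rintro rfl
    exact hne rfl
  · intro z hz
    exact ⟨(z, r), by simpa using hz, Metric.mem_ball_self hr0⟩

/-- `(2πi)⁻¹ ∫_Γ f(λ) (λ1 - A)⁻¹ dλ`, computed entrywise. -/
def cauchyMatrix {N : ℕ} (f : ℂ → ℂ) (A : Matrix (Fin N) (Fin N) ℂ) (Γ : Finset (ℂ × ℝ)) :
    Matrix (Fin N) (Fin N) ℂ :=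
  Matrix.of fun i j => (2 * (Real.pi : ℂ) * Complex.I)⁻¹ *
    ∑ d ∈ Γ, ∮ z in C(d.1, d.2), f z * (z • (1 : Matrix (Fin N) (Fin N) ℂ) - A)⁻¹ i j

/-- The function `f(A)` of the matrix `A`, for `f` analytic on an open set `U` containing the
spectrum of `A`, by the Cauchy integral over a contour in `U` surrounding the spectrum. (For such
`f` the value does not depend on the contour, by Cauchy's theorem.) -/
def matrixFunction {N : ℕ} (U : Set ℂ) (hU : IsOpen U) (f : ℂ → ℂ)
    (A : Matrix (Fin N) (Fin N) ℂ) (hA : spectrum ℂ A ⊆ U) : Matrix (Fin N) (Fin N) ℂ :=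
  cauchyMatrix f A (exists_contour U (spectrum ℂ A) hU (Matrix.finite_spectrum A) hA).choose

/-- `ℂ ∖ iℝ`. -/
def offAxis : Set ℂ := {z : ℂ | z.re ≠ 0}

theorem isOpen_offAxis : IsOpen offAxis :=
  isOpen_ne_fun Complex.continuous_re continuous_const

/-- `exp⁺_t`; only its values off the imaginary axis are used. -/
def expPlus (t : ℝ) (z : ℂ) : ℂ := if z.re < 0 then Complex.exp (z * t) else 0

/-- `exp⁻_t`; only its values off the imaginary axis are used. -/
def expMinus (t : ℝ) (z : ℂ) : ℂ := if 0 < z.re then Complex.exp (z * t) else 0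

/-- `g_t`; only `t ≠ 0` is used. -/
def greenSymbol (t : ℝ) (z : ℂ) : ℂ := if t < 0 then -expMinus t z else expPlus t z

/-- Green's function `𝒢(t) = g_t(A)`, `t ≠ 0`, of the bounded solutions problem for
`x' = A x + f`, where the spectrum of `A` does not meet the imaginary axis. -/
def greenFunction {N : ℕ} (A : Matrix (Fin N) (Fin N) ℂ) (hA : spectrum ℂ A ⊆ offAxis) (t : ℝ) :
    Matrix (Fin N) (Fin N) ℂ :=
  matrixFunction offAxis isOpen_offAxis (greenSymbol t) A hA

/-- The norm of the matrix `B` as an operator on `ℂ^N` equipped with the norm `p`: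
the least `c ≥ 0` with `p (B x) ≤ c * p x` for all `x`. -/
def inducedNorm {N : ℕ} (p : Seminorm ℂ (Fin N → ℂ)) (B : Matrix (Fin N) (Fin N) ℂ) : ℝ :=
  sInf {c : ℝ | 0 ≤ c ∧ ∀ x : Fin N → ℂ, p (B *ᵥ x) ≤ c * p x}

/-- The binomial coefficient `C(k+i-1, k-1)`, with the convention that for `k = 0` it is `1` if
`i = 0` and `0` if `i ≥ 1`. -/
def binomCoeff (k i : ℕ) : ℕ :=
  if k = 0 then (if i = 0 then 1 else 0) else (k + i - 1).choose (k - 1)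

end GreenEstimate

end

noncomputable section

namespace GreenEstimate

/-! On each circle `g_t` is either `0` or `±e^{λt}`, so only circles on one side of the axis
contribute. Write `t = rτ` with `r = ±1`, `τ > 0`, and list the eigenvalues with those outside the
remaining circles first. The resolvent has the finite Newton expansion `∑_j ∏_{l≤j} (z - λ_l)⁻¹
∏_{l<j} (A - λ_l)` (`cauchyMatrix_eq_newtonSum`). Each factor `A - λ_l` costs at most `2‖A‖`, and
coefficients with no pole inside vanish by Cauchy's theorem.

The other coefficients are bounded in two steps. At time `0` they are integrals of products of
simple poles; partial fractions between an outer and an inner pole give Pascal's recursion, hence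
the binomials and powers of `γ` (`norm_contourIntegral_poleKernel_le`). In time they form a chain of
linear ODEs, each driven by the coefficient with one inner pole fewer; comparison along the chain
gives the exponential and the powers of `t` (`norm_expCoeff_le`). -/

/-! ### Contour integrals of products of simple poles -/

/-- `(2πi)⁻¹ ∫_Γ f(z) dz`. -/
def contourIntegral (Γ : Finset (ℂ × ℝ)) (f : ℂ → ℂ) : ℂ :=
  (2 * (Real.pi : ℂ) * Complex.I)⁻¹ * ∑ d ∈ Γ, ∮ z in C(d.1, d.2), f z

/-- `∏ (z - w)⁻¹` over the points `w` of a multiset. -/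
def poleKernel (W : Multiset ℂ) (z : ℂ) : ℂ := ((W.map fun w => z - w).prod)⁻¹

@[simp] theorem poleKernel_zero (z : ℂ) : poleKernel 0 z = 1 := by simp [poleKernel]

@[simp] theorem poleKernel_cons (w : ℂ) (W : Multiset ℂ) (z : ℂ) :
    poleKernel (w ::ₘ W) z = (z - w)⁻¹ * poleKernel W z := by
  simp [poleKernel, mul_comm]

theorem differentiableAt_poleKernel {W : Multiset ℂ} {z : ℂ} (h : z ∉ W) :
    DifferentiableAt ℂ (poleKernel W) z := by
  induction W using Multiset.induction_on with
  | empty =>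
    have : poleKernel 0 = fun _ => 1 := by ext; simp
    rw [this]; fun_prop
  | cons w W ih =>
    have e : poleKernel (w ::ₘ W) = fun z => (z - w)⁻¹ * poleKernel W z := by ext; simp
    rw [Multiset.mem_cons, not_or] at h
    rw [e]
    exact DifferentiableAt.mul (DifferentiableAt.inv (by fun_prop) (sub_ne_zero.2 h.1)) (ih h.2)

theorem poleKernel_partial_fractions {a b z : ℂ} (W : Multiset ℂ) (ha : z ≠ a) (hb : z ≠ b) :
    (b - a) * poleKernel (a ::ₘ b ::ₘ W) z = poleKernel (b ::ₘ W) z - poleKernel (a ::ₘ W) z := by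
  have h1 := sub_ne_zero.2 ha
  have h2 := sub_ne_zero.2 hb
  simp only [poleKernel_cons]
  field_simp
  ring

theorem contourIntegral_congr {Γ : Finset (ℂ × ℝ)} (hΓ : ∀ d ∈ Γ, 0 < d.2) {f g : ℂ → ℂ}
    (h : ∀ d ∈ Γ, ∀ z ∈ Metric.sphere d.1 d.2, f z = g z) :
    contourIntegral Γ f = contourIntegral Γ g := by
  unfold contourIntegral
  congr 1
  exact Finset.sum_congr rfl fun d hd => circleIntegral.integral_congr (hΓ d hd).le (h d hd)

theorem contourIntegral_const_mul (Γ : Finset (ℂ × ℝ)) (a : ℂ) (f : ℂ → ℂ) :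
    contourIntegral Γ (fun z => a * f z) = a * contourIntegral Γ f := by
  unfold contourIntegral
  simp only [circleIntegral.integral_const_mul, ← Finset.mul_sum]
  ring

theorem contourIntegral_sub {Γ : Finset (ℂ × ℝ)} (hΓ : ∀ d ∈ Γ, 0 < d.2) {f g : ℂ → ℂ}
    (hf : ∀ d ∈ Γ, ContinuousOn f (Metric.sphere d.1 d.2))
    (hg : ∀ d ∈ Γ, ContinuousOn g (Metric.sphere d.1 d.2)) :
    contourIntegral Γ (fun z => f z - g z) = contourIntegral Γ f - contourIntegral Γ g := by
  unfold contourIntegral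
  rw [← mul_sub, ← Finset.sum_sub_distrib]
  congr 1
  exact Finset.sum_congr rfl fun d hd => circleIntegral.integral_sub
    ((hf d hd).circleIntegrable (hΓ d hd).le) ((hg d hd).circleIntegrable (hΓ d hd).le)

theorem contourIntegral_fun_sum {ι : Type*} (s : Finset ι) {Γ : Finset (ℂ × ℝ)}
    (hΓ : ∀ d ∈ Γ, 0 < d.2) {f : ι → ℂ → ℂ}
    (hf : ∀ i ∈ s, ∀ d ∈ Γ, ContinuousOn (f i) (Metric.sphere d.1 d.2)) :
    contourIntegral Γ (fun z => ∑ i ∈ s, f i z) = ∑ i ∈ s, contourIntegral Γ (f i) := by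
  unfold contourIntegral
  rw [← Finset.mul_sum, Finset.sum_comm]
  congr 1
  exact Finset.sum_congr rfl fun d hd => circleIntegral.integral_fun_sum
    fun i hi => (hf i hi d hd).circleIntegrable (hΓ d hd).le

theorem contourIntegral_eq_zero {Γ : Finset (ℂ × ℝ)} (hΓ : ∀ d ∈ Γ, 0 < d.2) {f : ℂ → ℂ}
    (hf : ∀ d ∈ Γ, ∀ z ∈ Metric.closedBall d.1 d.2, DifferentiableAt ℂ f z) :
    contourIntegral Γ f = 0 := by
  unfold contourIntegral
  rw [Finset.sum_eq_zero, mul_zero]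
  intro d hd
  exact Complex.circleIntegral_eq_zero_of_differentiable_on_off_countable (hΓ d hd).le
    Set.countable_empty (fun z hz => (hf d hd z hz).continuousAt.continuousWithinAt)
    fun z hz => hf d hd z (Metric.ball_subset_closedBall hz.1)

theorem contourIntegral_sub_inv {U K : Set ℂ} {Γ : Finset (ℂ × ℝ)} (hΓ : IsContourAround U K Γ)
    {w : ℂ} (hw : w ∈ K) : contourIntegral Γ (fun z => (z - w)⁻¹) = 1 := by
  obtain ⟨d, hd, hwd⟩ := hΓ.surrounds w hw
  unfold contourIntegral
  rw [Finset.sum_eq_single_of_mem d hd, circleIntegral.integral_sub_inv_of_mem_ball hwd]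
  · exact inv_mul_cancel₀ Complex.two_pi_I_ne_zero
  · intro d' hd' hne
    have hdis := hΓ.disjoint_discs d' hd' d hd hne
    have hne : ∀ z ∈ Metric.closedBall d'.1 d'.2, DifferentiableAt ℂ (fun z => (z - w)⁻¹) z := by
      intro z hz
      refine DifferentiableAt.inv (by fun_prop) (sub_ne_zero.2 ?_)
      rintro rfl
      exact Set.disjoint_left.1 hdis hz (Metric.ball_subset_closedBall hwd)
    exact Complex.circleIntegral_eq_zero_of_differentiable_on_off_countable
      (hΓ.radius_pos d' hd').le
      Set.countable_empty (fun z hz => (hne z hz).continuousAt.continuousWithinAt)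
      fun z hz => hne z (Metric.ball_subset_closedBall hz.1)

theorem IsContourAround.notMem_sphere {U K : Set ℂ} {Γ : Finset (ℂ × ℝ)}
    (hΓ : IsContourAround U K Γ) {w : ℂ} (hw : w ∈ K) {d : ℂ × ℝ} (hd : d ∈ Γ) :
    w ∉ Metric.sphere d.1 d.2 := by
  intro hs
  obtain ⟨d', hd', hwd⟩ := hΓ.surrounds w hw
  by_cases h : d = d'
  · subst h
    exact (Metric.mem_ball.1 hwd).ne (Metric.mem_sphere.1 hs)
  · exact Set.disjoint_left.1 (hΓ.disjoint_discs d hd d' hd' h)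
      (Metric.sphere_subset_closedBall hs) (Metric.ball_subset_closedBall hwd)

theorem continuousOn_poleKernel {W : Multiset ℂ} {s : Set ℂ} (h : ∀ w ∈ W, w ∉ s) :
    ContinuousOn (poleKernel W) s := fun z hz =>
  (differentiableAt_poleKernel fun hW => h z hW hz).continuousAt.continuousWithinAt

theorem contourIntegral_partial_fractions {Γ : Finset (ℂ × ℝ)} (hΓ : ∀ d ∈ Γ, 0 < d.2)
    {a b : ℂ} {W : Multiset ℂ}
    (h : ∀ w ∈ a ::ₘ b ::ₘ W, ∀ d ∈ Γ, w ∉ Metric.sphere d.1 d.2) :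
    (b - a) * contourIntegral Γ (poleKernel (a ::ₘ b ::ₘ W)) =
      contourIntegral Γ (poleKernel (b ::ₘ W)) - contourIntegral Γ (poleKernel (a ::ₘ W)) := by
  simp only [Multiset.mem_cons, forall_eq_or_imp] at h
  rw [← contourIntegral_const_mul, ← contourIntegral_sub hΓ]
  · refine contourIntegral_congr hΓ fun d hd z hz => poleKernel_partial_fractions W ?_ ?_
    · rintro rfl; exact h.1 d hd hz
    · rintro rfl; exact h.2.1 d hd hz
  · intro d hd
    refine continuousOn_poleKernel fun w hw => ?_
    rcases Multiset.mem_cons.1 hw with rfl | hw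
    exacts [h.2.1 d hd, h.2.2 w hw d hd]
  · intro d hd
    refine continuousOn_poleKernel fun w hw => ?_
    rcases Multiset.mem_cons.1 hw with rfl | hw
    exacts [h.1 d hd, h.2.2 w hw d hd]

/-- Two distinct poles can be split by partial fractions, which lowers their number and ends at `1 -
1 = 0`. If all poles coincide, the integrand is a power `(z - a)⁻ⁿ` with `n ≥ 2`, which has a
primitive. -/
theorem contourIntegral_poleKernel_eq_zero {U K : Set ℂ} {Γ : Finset (ℂ × ℝ)}
    (hΓ : IsContourAround U K Γ) (n : ℕ) :
    ∀ T : Multiset ℂ, T.card = n + 2 → (∀ w ∈ T, w ∈ K) →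
      contourIntegral Γ (poleKernel T) = 0 := by
  induction n with
  | zero =>
    intro T hT hK
    obtain ⟨a, b, rfl⟩ := Multiset.card_eq_two.1 hT
    by_cases hab : a = b
    · subst hab
      unfold contourIntegral
      rw [Finset.sum_eq_zero, mul_zero]
      intro d _
      rw [← circleIntegral.integral_sub_zpow_of_ne (n := -2) (by norm_num) d.1 a d.2]
      congr 1
      ext z
      simp [poleKernel, zpow_neg, zpow_ofNat, sq]
    · have h := contourIntegral_partial_fractions hΓ.radius_pos (a := a) (b := b) (W := 0)
        fun w hw d hd => hΓ.notMem_sphere (hK w hw) hd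
      have e : ∀ c ∈ K, contourIntegral Γ (poleKernel (c ::ₘ 0)) = 1 := fun c hc => by
        rw [← contourIntegral_sub_inv hΓ hc]
        congr 1
        ext z
        simp [poleKernel]
      rw [e a (hK a (by simp)), e b (hK b (by simp)), sub_self] at h
      exact (mul_eq_zero.1 h).resolve_left (sub_ne_zero.2 (Ne.symm hab))
  | succ n ih =>
    intro T hT hK
    by_cases hd : ∃ a b W, T = a ::ₘ b ::ₘ W ∧ a ≠ b
    · obtain ⟨a, b, W, rfl, hab⟩ := hd
      have h := contourIntegral_partial_fractions hΓ.radius_pos (a := a) (b := b) (W := W)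
        fun w hw d hd => hΓ.notMem_sphere (hK w hw) hd
      simp only [Multiset.card_cons] at hT
      simp only [Multiset.mem_cons, forall_eq_or_imp] at hK
      rw [ih (b ::ₘ W) (by simp; omega) (by simpa using hK.2),
        ih (a ::ₘ W) (by simp; omega) (by simpa using ⟨hK.1, hK.2.2⟩), sub_self] at h
      exact (mul_eq_zero.1 h).resolve_left (sub_ne_zero.2 (Ne.symm hab))
    · push Not at hd
      obtain ⟨a, ha⟩ := Multiset.card_pos_iff_exists_mem.1 (by omega : 0 < T.card)
      obtain ⟨T', rfl⟩ := Multiset.exists_cons_of_mem ha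
      have hrep : a ::ₘ T' = Multiset.replicate (n + 3) a := by
        refine Multiset.eq_replicate.2 ⟨hT, fun b hb => ?_⟩
        rcases Multiset.mem_cons.1 hb with rfl | hb
        · rfl
        · obtain ⟨W, rfl⟩ := Multiset.exists_cons_of_mem hb
          exact (hd a b W rfl).symm
      rw [hrep]
      unfold contourIntegral
      rw [Finset.sum_eq_zero, mul_zero]
      intro d _
      rw [← circleIntegral.integral_sub_zpow_of_ne (n := -((n + 3 : ℕ) : ℤ)) (by omega) d.1 a d.2]
      congr 1
      ext z
      rw [poleKernel, Multiset.map_replicate, Multiset.prod_replicate, zpow_neg, zpow_natCast]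

theorem binomCoeff_succ_zero (k : ℕ) : binomCoeff (k + 1) 0 = 1 := by simp [binomCoeff]

/-- Pascal's rule; the convention at `k = 0` is what keeps it valid there. -/
theorem binomCoeff_succ_succ (k i : ℕ) :
    binomCoeff (k + 1) (i + 1) = binomCoeff k (i + 1) + binomCoeff (k + 1) i := by
  rcases k with _ | k
  · simp [binomCoeff]
  · simp only [binomCoeff, Nat.add_eq_zero_iff, one_ne_zero, and_false, if_false]
    have e1 : k + 1 + 1 + (i + 1) - 1 = (k + i + 1) + 1 := by omega
    have e2 : k + 1 + 1 - 1 = k + 1 := by omega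
    have e3 : k + 1 + (i + 1) - 1 = k + i + 1 := by omega
    have e4 : k + 1 + 1 + i - 1 = k + i + 1 := by omega
    have e5 : k + 1 - 1 = k := by omega
    rw [e1, e2, e3, e4, e5, Nat.choose_succ_succ]

theorem binomCoeff_zero_le (k : ℕ) : binomCoeff k 0 ≤ 1 := by
  rcases k with _ | k <;> simp [binomCoeff]

/-- Double induction on the outer poles `S` and inner poles `T`. Splitting `a ∈ S` from `b ∈ T`
costs a factor `γ⁻¹` and leaves two integrals, one without `a` and one without `b`; their bounds add
up by Pascal's rule. With `S` empty the integral is `1` for a single pole and `0` otherwise. -/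
theorem norm_contourIntegral_poleKernel_le {U K : Set ℂ} {Γ : Finset (ℂ × ℝ)}
    (hΓ : IsContourAround U K Γ) {γ : ℝ} (hγ : 0 < γ) (S : Multiset ℂ) :
    ∀ (T : Multiset ℂ) (i : ℕ), T.card = i + 1 →
      (∀ w ∈ S, ∀ d ∈ Γ, w ∉ Metric.closedBall d.1 d.2) → (∀ w ∈ T, w ∈ K) →
      (∀ a ∈ S, ∀ b ∈ T, γ ≤ ‖b - a‖) →
      ‖contourIntegral Γ (poleKernel (S + T))‖ ≤ binomCoeff S.card i / γ ^ (S.card + i) := by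
  induction S using Multiset.induction_on with
  | empty =>
    intro T i hT _ hK _
    rcases i with _ | i
    · obtain ⟨a, rfl⟩ := Multiset.card_eq_one.1 hT
      have : contourIntegral Γ (poleKernel {a}) = 1 := by
        rw [← contourIntegral_sub_inv hΓ (hK a (by simp))]
        congr 1
        ext z
        simp [poleKernel]
      simp [this, binomCoeff]
    · rw [zero_add, contourIntegral_poleKernel_eq_zero hΓ i T hT hK, norm_zero]
      positivity
  | cons a S ihS =>
    intro T
    induction T using Multiset.induction_on with
    | empty => intro i hi; simp at hi
    | cons b T ihT =>
      intro i hi hS hK hd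
      have hi' : T.card = i := by simpa using hi
      have hW : a ::ₘ S + b ::ₘ T = a ::ₘ b ::ₘ (S + T) := by
        rw [Multiset.cons_add, Multiset.add_cons]
      have h := contourIntegral_partial_fractions hΓ.radius_pos (a := a) (b := b) (W := S + T)
        (by
          intro w hw d hd
          rw [← hW, Multiset.mem_add] at hw
          rcases hw with hw | hw
          · exact fun hs => hS w hw d hd (Metric.sphere_subset_closedBall hs)
          · exact hΓ.notMem_sphere (hK w hw) hd)
      have hab : γ ≤ ‖b - a‖ := hd a (by simp) b (by simp)
      have h1 := ihS (b ::ₘ T) i hi (fun w hw => hS w (Multiset.mem_cons_of_mem hw)) hK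
        (fun x hx y hy => hd x (Multiset.mem_cons_of_mem hx) y hy)
      rw [Multiset.add_cons] at h1
      -- Writing Pascal's rule as a difference also covers `i = 0`, where every remaining pole is
      -- outside and the integral is zero.
      have h2 : ‖contourIntegral Γ (poleKernel (a ::ₘ (S + T)))‖ ≤
          (binomCoeff (S.card + 1) i - binomCoeff S.card i : ℝ) / γ ^ (S.card + i) := by
        rcases i with _ | i
        · have hT0 : T = 0 := Multiset.card_eq_zero.1 hi'
          subst hT0
          rw [contourIntegral_eq_zero hΓ.radius_pos, norm_zero]
          · rw [binomCoeff_succ_zero]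
            have : (binomCoeff S.card 0 : ℝ) ≤ 1 := by exact_mod_cast binomCoeff_zero_le _
            have : (0 : ℝ) ≤ ((1 : ℕ) : ℝ) - binomCoeff S.card 0 := by push_cast; linarith
            positivity
          · intro d hd z hz
            refine differentiableAt_poleKernel fun hz' => hS z ?_ d hd hz
            simpa using hz'
        · have h3 := ihT i hi' hS (fun w hw => hK w (Multiset.mem_cons_of_mem hw))
            (fun x hx y hy => hd x hx y (Multiset.mem_cons_of_mem hy))
          rw [Multiset.cons_add, Multiset.card_cons] at h3
          refine h3.trans (le_of_eq ?_)
          rw [binomCoeff_succ_succ]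
          push_cast
          congr 1
          · ring
          · ring
      rw [hW, Multiset.card_cons]
      have h4 : γ * ‖contourIntegral Γ (poleKernel (a ::ₘ b ::ₘ (S + T)))‖ ≤
          binomCoeff (S.card + 1) i / γ ^ (S.card + i) := by
        calc _ ≤ ‖b - a‖ * ‖contourIntegral Γ (poleKernel (a ::ₘ b ::ₘ (S + T)))‖ := by gcongr
          _ = ‖contourIntegral Γ (poleKernel (b ::ₘ (S + T))) -
                contourIntegral Γ (poleKernel (a ::ₘ (S + T)))‖ := by rw [← norm_mul, h]
          _ ≤ _ := (norm_sub_le _ _).trans (add_le_add h1 h2)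
          _ = _ := by rw [← add_div]; congr 1; ring
      rw [le_div_iff₀ (by positivity)] at h4 ⊢
      calc _ = γ * ‖contourIntegral Γ (poleKernel (a ::ₘ b ::ₘ (S + T)))‖ * γ ^ (S.card + i) := by
            ring
        _ ≤ _ := h4


/-! ### Time dependence of the Newton coefficients -/

theorem hasDerivAt_circleIntegral_exp_mul (σ c : ℂ) {R : ℝ} (hR : 0 < R) {h : ℂ → ℂ}
    (hh : ContinuousOn h (Metric.sphere c R)) (t : ℝ) :
    HasDerivAt (fun s : ℝ => ∮ z in C(c, R), Complex.exp (σ * z * s) * h z)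
      (∮ z in C(c, R), σ * z * (Complex.exp (σ * z * t) * h z)) t := by
  have hc : Continuous fun θ : ℝ => h (circleMap c R θ) :=
    hh.comp_continuous (continuous_circleMap c R) fun θ => circleMap_mem_sphere c hR.le θ
  have hc2 : Continuous fun x : ℝ × ℝ => h (circleMap c R x.2) := hc.comp continuous_snd
  have hm : Continuous (circleMap c R) := continuous_circleMap c R
  have hm0 : Continuous (circleMap 0 R) := continuous_circleMap 0 R
  let F : ℝ → ℝ → ℂ := fun s θ => deriv (circleMap c R) θ •
    (Complex.exp (σ * circleMap c R θ * s) * h (circleMap c R θ))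
  let F' : ℝ → ℝ → ℂ := fun s θ => deriv (circleMap c R) θ •
    (σ * circleMap c R θ * (Complex.exp (σ * circleMap c R θ * s) * h (circleMap c R θ)))
  have hF : Continuous fun x : ℝ × ℝ => F x.1 x.2 := by
    simp only [F, deriv_circleMap, smul_eq_mul]
    refine Continuous.mul ?_ (Continuous.mul ?_ hc2) <;> fun_prop
  have hF' : Continuous fun x : ℝ × ℝ => F' x.1 x.2 := by
    simp only [F', deriv_circleMap, smul_eq_mul]
    refine Continuous.mul ?_ (Continuous.mul ?_ (Continuous.mul ?_ hc2)) <;> fun_prop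
  have hF1 : ∀ s, Continuous (F s) := fun s => hF.comp (Continuous.prodMk_right s)
  have hF'1 : ∀ s, Continuous (F' s) := fun s => hF'.comp (Continuous.prodMk_right s)
  -- Compactness supplies the constant that dominates the derivative for times near `t`.
  obtain ⟨C, hC⟩ := ((isCompact_closedBall t 1).prod
    (isCompact_uIcc (a := 0) (b := 2 * Real.pi))).exists_bound_of_continuousOn hF'.continuousOn
  refine (intervalIntegral.hasDerivAt_integral_of_dominated_loc_of_deriv_le (F := F) (F' := F')
    (bound := fun _ => C) (Metric.closedBall_mem_nhds t one_pos)
    (Filter.Eventually.of_forall fun s => (hF1 s).aestronglyMeasurable)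
    ((hF1 t).intervalIntegrable _ _) (hF'1 t).aestronglyMeasurable
    (Filter.Eventually.of_forall fun θ hθ s hs =>
      hC (s, θ) ⟨hs, Set.uIoc_subset_uIcc hθ⟩) (by simp)
    (Filter.Eventually.of_forall fun θ _ s _ => ?_)).2
  simp only [F, F', smul_eq_mul]
  have h1 : HasDerivAt (fun s : ℝ => σ * circleMap c R θ * (s : ℂ)) (σ * circleMap c R θ) s := by
    simpa using (Complex.ofRealCLM.hasDerivAt (x := s)).const_mul (σ * circleMap c R θ)
  refine ((h1.cexp.mul_const (h (circleMap c R θ))).const_mul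
    (deriv (circleMap c R) θ)).congr_deriv ?_
  ring

theorem hasDerivAt_contourIntegral_exp_mul (σ : ℂ) {Γ : Finset (ℂ × ℝ)} (hΓ : ∀ d ∈ Γ, 0 < d.2)
    {h : ℂ → ℂ} (hh : ∀ d ∈ Γ, ContinuousOn h (Metric.sphere d.1 d.2)) (t : ℝ) :
    HasDerivAt (fun s : ℝ => contourIntegral Γ fun z => Complex.exp (σ * z * s) * h z)
      (contourIntegral Γ fun z => σ * z * (Complex.exp (σ * z * t) * h z)) t :=
  (HasDerivAt.fun_sum fun d hd =>
    hasDerivAt_circleIntegral_exp_mul σ d.1 (hΓ d hd) (hh d hd) t).const_mul _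

/-- `(2πi)⁻¹ ∫_Γ e^{σzt} ∏ (z - w)⁻¹ dz` over the points `w` of a multiset. -/
def expCoeff (σ : ℂ) (Γ : Finset (ℂ × ℝ)) (W : Multiset ℂ) (t : ℝ) : ℂ :=
  contourIntegral Γ fun z => Complex.exp (σ * z * t) * poleKernel W z

/-- Differentiation brings down `σz = σ(z - w) + σw`, and `z - w` cancels the pole at `w`. -/
theorem hasDerivAt_expCoeff_cons (σ : ℂ) {Γ : Finset (ℂ × ℝ)} (hΓ : ∀ d ∈ Γ, 0 < d.2) {w : ℂ}
    {W : Multiset ℂ} (h : ∀ v ∈ w ::ₘ W, ∀ d ∈ Γ, v ∉ Metric.sphere d.1 d.2) (t : ℝ) :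
    HasDerivAt (expCoeff σ Γ (w ::ₘ W))
      (σ * expCoeff σ Γ W t + σ * w * expCoeff σ Γ (w ::ₘ W) t) t := by
  have hc : ∀ d ∈ Γ, ContinuousOn (poleKernel (w ::ₘ W)) (Metric.sphere d.1 d.2) :=
    fun d hd => continuousOn_poleKernel fun v hv => h v hv d hd
  have hc' : ∀ d ∈ Γ, ContinuousOn (poleKernel W) (Metric.sphere d.1 d.2) :=
    fun d hd => continuousOn_poleKernel fun v hv => h v (Multiset.mem_cons_of_mem hv) d hd
  refine (hasDerivAt_contourIntegral_exp_mul σ hΓ hc t).congr_deriv (Eq.symm ?_)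
  unfold expCoeff
  rw [← sub_eq_zero, ← sub_neg_eq_add, ← neg_mul, ← contourIntegral_const_mul,
    ← contourIntegral_const_mul, ← contourIntegral_sub hΓ, ← contourIntegral_sub hΓ]
  · rw [contourIntegral_congr hΓ (g := fun _ => 0)]
    · simp [contourIntegral, circleIntegral]
    · intro d hd z hz
      have hz0 : z - w ≠ 0 := sub_ne_zero.2 (by
        rintro rfl
        exact h z (by simp) d hd hz)
      simp only [poleKernel_cons]
      field_simp
      ring
  all_goals intro d hd; have h1 := hc d hd; have h2 := hc' d hd; fun_prop

/-- `∑_{i<n} t^{n-1-i} / (n-1-i)! * a i`. -/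
def taylorSum (a : ℕ → ℝ) (n : ℕ) (t : ℝ) : ℝ :=
  ∑ i ∈ Finset.range n, t ^ (n - 1 - i) / ((n - 1 - i).factorial : ℝ) * a i

theorem taylorSum_succ (a : ℕ → ℝ) (n : ℕ) (t : ℝ) :
    taylorSum a (n + 1) t =
      ∑ i ∈ Finset.range n, t ^ (n - 1 - i + 1) / ((n - 1 - i + 1).factorial : ℝ) * a i + a n := by
  unfold taylorSum
  rw [Finset.sum_range_succ]
  congr 1
  · refine Finset.sum_congr rfl fun i hi => ?_
    have : n + 1 - 1 - i = n - 1 - i + 1 := by have := Finset.mem_range.1 hi; omega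
    rw [this]
  · simp

theorem taylorSum_succ_zero (a : ℕ → ℝ) (n : ℕ) : taylorSum a (n + 1) 0 = a n := by
  simp [taylorSum_succ]

theorem hasDerivAt_taylorSum_succ (a : ℕ → ℝ) (n : ℕ) (t : ℝ) :
    HasDerivAt (taylorSum a (n + 1)) (taylorSum a n t) t := by
  have e : taylorSum a (n + 1) = fun t => _ := funext (taylorSum_succ a n)
  rw [e]
  refine (HasDerivAt.fun_sum fun i _ => ?_).add_const _
  refine HasDerivAt.mul_const ?_ _
  convert (hasDerivAt_pow (n - 1 - i + 1) t).div_const _ using 1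
  rw [Nat.factorial_succ, Nat.add_sub_cancel]
  push_cast
  field_simp

/-- Induction on the inner poles. Removing the decay of the newest pole by an integrating factor
leaves a derivative controlled by the previous bound; integrating that bound in time from the
initial value gives the next `taylorSum`. With no inner pole the integrand is holomorphic on the
discs. -/
theorem norm_expCoeff_le {U K : Set ℂ} {Γ : Finset (ℂ × ℝ)} (hΓ : IsContourAround U K Γ)
    {γ g : ℝ} (hγ : 0 < γ) {σ : ℂ} (hσ : ‖σ‖ = 1) {S : Multiset ℂ}
    (hS : ∀ w ∈ S, ∀ d ∈ Γ, w ∉ Metric.closedBall d.1 d.2) (T : Multiset ℂ) :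
    (∀ w ∈ T, w ∈ K) → (∀ a ∈ S, ∀ b ∈ T, γ ≤ ‖b - a‖) → (∀ b ∈ T, (σ * b).re ≤ -g) →
      ∀ t : ℝ, 0 ≤ t → ‖expCoeff σ Γ (S + T) t‖ ≤ Real.exp (-g * t) *
        taylorSum (fun i => binomCoeff S.card i / γ ^ (S.card + i)) T.card t := by
  induction T using Multiset.induction_on with
  | empty =>
    intro _ _ _ t _
    rw [expCoeff, contourIntegral_eq_zero hΓ.radius_pos]
    · simp [taylorSum]
    · intro d hd z hz
      refine DifferentiableAt.mul (by fun_prop) (differentiableAt_poleKernel fun hz' => ?_)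
      exact hS z (by simpa using hz') d hd hz
  | cons w T ih =>
    intro hK hd hg t ht
    have ih' := ih (fun v hv => hK v (Multiset.mem_cons_of_mem hv))
      (fun a ha b hb => hd a ha b (Multiset.mem_cons_of_mem hb))
      (fun b hb => hg b (Multiset.mem_cons_of_mem hb))
    have hw : (σ * w).re ≤ -g := hg w (by simp)
    have h0 := norm_contourIntegral_poleKernel_le hΓ hγ S (w ::ₘ T) T.card (by simp) hS hK hd
    have hsph : ∀ v ∈ w ::ₘ (S + T), ∀ d ∈ Γ, v ∉ Metric.sphere d.1 d.2 := by
      intro v hv d hd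
      rw [← Multiset.add_cons, Multiset.mem_add] at hv
      rcases hv with hv | hv
      · exact fun hs => hS v hv d hd (Metric.sphere_subset_closedBall hs)
      · exact hΓ.notMem_sphere (hK v hv) hd
    rw [Multiset.add_cons] at h0 ⊢
    rw [Multiset.card_cons]
    set a : ℕ → ℝ := fun i => binomCoeff S.card i / γ ^ (S.card + i) with ha
    -- Duhamel's integrand with the final time `t` fixed: at `s = t` it is the wanted coefficient,
    -- and its derivative no longer contains that coefficient.
    let f : ℝ → ℂ := fun s => Complex.exp (σ * w * (t - s)) * expCoeff σ Γ (w ::ₘ (S + T)) s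
    have hf : ∀ s : ℝ, HasDerivAt f
        (σ * (Complex.exp (σ * w * (t - s)) * expCoeff σ Γ (S + T) s)) s := by
      intro s
      have h1 : HasDerivAt (fun s : ℝ => σ * w * ((t : ℂ) - s)) (-(σ * w)) s := by
        simpa using ((Complex.ofRealCLM.hasDerivAt (x := s)).const_sub (t : ℂ)).const_mul (σ * w)
      refine (h1.cexp.mul (hasDerivAt_expCoeff_cons σ hΓ.radius_pos hsph s)).congr_deriv ?_
      ring
    have hexp : ∀ s : ℝ, s ≤ t → ‖Complex.exp (σ * w * (t - s))‖ ≤ Real.exp (-g * (t - s)) := by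
      intro s hs
      have : σ * w * ((t : ℂ) - s) = σ * w * ((t - s : ℝ) : ℂ) := by push_cast; ring
      rw [Complex.norm_exp, this, Complex.re_mul_ofReal, Real.exp_le_exp]
      exact mul_le_mul_of_nonneg_right hw (by linarith)
    have key := image_norm_le_of_norm_deriv_right_le_deriv_boundary (a := 0) (b := t) (f := f)
      (B := fun s => Real.exp (-g * t) * taylorSum a (T.card + 1) s)
      (B' := fun s => Real.exp (-g * t) * taylorSum a T.card s)
      (fun s _ => (hf s).continuousAt.continuousWithinAt) (fun s _ => (hf s).hasDerivWithinAt)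
      (by
        simp only [f, taylorSum_succ_zero, norm_mul]
        have e : expCoeff σ Γ (w ::ₘ (S + T)) 0 =
            contourIntegral Γ (poleKernel (w ::ₘ (S + T))) := by
          simp [expCoeff, -poleKernel_cons]
        rw [e]
        have := hexp 0 ht
        rw [sub_zero] at this
        exact mul_le_mul this h0 (norm_nonneg _) (Real.exp_pos _).le)
      (fun s => (hasDerivAt_taylorSum_succ a _ s).const_mul _)
      (by
        intro s hs
        rw [norm_mul, norm_mul, hσ, one_mul]
        refine (mul_le_mul (hexp s hs.2.le) (ih' s hs.1) (norm_nonneg _)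
          (Real.exp_pos _).le).trans (le_of_eq ?_)
        rw [← mul_assoc, ← Real.exp_add]
        congr 2
        ring)
      (Set.right_mem_Icc.2 ht)
    simpa [f] using key


/-! ### The induced norm -/

/-- Linear maps in finite dimension are continuous. This makes the set in `inducedNorm` nonempty, so
its infimum is a genuine bound. -/
theorem exists_seminorm_bound {E : Type*} [AddCommGroup E] [Module ℂ E] [FiniteDimensional ℂ E]
    (p : Seminorm ℂ E) (hp : ∀ x, p x = 0 → x = 0) (f : E →ₗ[ℂ] E) :
    ∃ c : ℝ, 0 ≤ c ∧ ∀ x, p (f x) ≤ c * p x := by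
  let q : AddGroupNorm E := { p.toAddGroupSeminorm with eq_zero_of_map_eq_zero' := hp }
  let _ : NormedAddCommGroup E := q.toNormedAddCommGroup
  let _ : NormedSpace ℂ E := ⟨fun a x => (map_smul_eq_mul p a x).le⟩
  exact ⟨‖f.toContinuousLinearMap‖, norm_nonneg _, fun x => f.toContinuousLinearMap.le_opNorm x⟩

variable {N : ℕ}

theorem inducedNorm_nonneg (p : Seminorm ℂ (Fin N → ℂ)) (B : Matrix (Fin N) (Fin N) ℂ) :
    0 ≤ inducedNorm p B := Real.sInf_nonneg fun _ hc => hc.1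

theorem inducedNorm_le {p : Seminorm ℂ (Fin N → ℂ)} {B : Matrix (Fin N) (Fin N) ℂ} {c : ℝ}
    (hc : 0 ≤ c) (h : ∀ x, p (B *ᵥ x) ≤ c * p x) : inducedNorm p B ≤ c :=
  csInf_le ⟨0, fun _ hc => hc.1⟩ ⟨hc, h⟩

theorem le_inducedNorm_mul {p : Seminorm ℂ (Fin N → ℂ)} (hp : ∀ x, p x = 0 → x = 0)
    (B : Matrix (Fin N) (Fin N) ℂ) (x : Fin N → ℂ) : p (B *ᵥ x) ≤ inducedNorm p B * p x := by
  obtain ⟨c, hc, h⟩ := exists_seminorm_bound p hp B.mulVecLin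
  rcases (apply_nonneg p x).eq_or_lt with hx | hx
  · simpa [← hx] using h x
  · rw [← div_le_iff₀ hx]
    refine le_csInf ⟨c, hc, fun y => by simpa using h y⟩ fun b hb => ?_
    rw [div_le_iff₀ hx]
    exact hb.2 x

theorem inducedNorm_neg (p : Seminorm ℂ (Fin N → ℂ)) (B : Matrix (Fin N) (Fin N) ℂ) :
    inducedNorm p (-B) = inducedNorm p B := by
  simp [inducedNorm, Matrix.neg_mulVec]

theorem norm_le_inducedNorm_of_mem_spectrum {p : Seminorm ℂ (Fin N → ℂ)}
    (hp : ∀ x, p x = 0 → x = 0) {A : Matrix (Fin N) (Fin N) ℂ} {z : ℂ} (hz : z ∈ spectrum ℂ A) :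
    ‖z‖ ≤ inducedNorm p A := by
  rw [← Matrix.spectrum_toLin', ← Module.End.hasEigenvalue_iff_mem_spectrum] at hz
  obtain ⟨v, hv⟩ := hz.exists_hasEigenvector
  have h := hv.apply_eq_smul
  rw [Matrix.toLin'_apply] at h
  have hv0 : 0 < p v := (apply_nonneg p v).lt_of_ne fun h0 => hv.2 (hp v h0.symm)
  have h1 := le_inducedNorm_mul hp A v
  rw [h, map_smul_eq_mul] at h1
  exact le_of_mul_le_mul_right h1 hv0

/-! ### Newton expansion of the resolvent -/

/-- `∏_{l<n} (A - λ_l)`. -/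
def newtonMatrix (A : Matrix (Fin N) (Fin N) ℂ) (lam : ℕ → ℂ) (n : ℕ) :
    Matrix (Fin N) (Fin N) ℂ :=
  Polynomial.aeval A (((Multiset.range n).map fun l => Polynomial.X - Polynomial.C (lam l)).prod)

theorem newtonMatrix_zero (A : Matrix (Fin N) (Fin N) ℂ) (lam : ℕ → ℂ) :
    newtonMatrix A lam 0 = 1 := by simp [newtonMatrix]

theorem newtonMatrix_succ (A : Matrix (Fin N) (Fin N) ℂ) (lam : ℕ → ℂ) (n : ℕ) :
    newtonMatrix A lam (n + 1) = (A - lam n • (1 : Matrix (Fin N) (Fin N) ℂ)) *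
      newtonMatrix A lam n := by
  simp [newtonMatrix, Multiset.range_succ, Algebra.algebraMap_eq_smul_one]

/-- Cayley–Hamilton: the full product is the characteristic polynomial evaluated at `A`. -/
theorem newtonMatrix_eq_zero {A : Matrix (Fin N) (Fin N) ℂ} {lam : ℕ → ℂ} {n : ℕ}
    (h : A.charpoly.roots = (Multiset.range n).map lam) : newtonMatrix A lam n = 0 := by
  have h1 := (IsAlgClosed.splits A.charpoly).eq_prod_roots_of_monic (Matrix.charpoly_monic A)
  rw [h, Multiset.map_map] at h1
  rw [← Matrix.aeval_self_charpoly A, newtonMatrix]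
  conv_rhs => rw [h1]
  rfl

theorem newtonMatrix_mulVec_le {p : Seminorm ℂ (Fin N → ℂ)} (hp : ∀ x, p x = 0 → x = 0)
    {A : Matrix (Fin N) (Fin N) ℂ} {lam : ℕ → ℂ} (n : ℕ)
    (h : ∀ l < n, lam l ∈ spectrum ℂ A) (x : Fin N → ℂ) :
    p (newtonMatrix A lam n *ᵥ x) ≤ (2 * inducedNorm p A) ^ n * p x := by
  induction n with
  | zero => simp [newtonMatrix_zero]
  | succ n ih =>
    have ih' := ih fun l hl => h l (by omega)
    have hl := norm_le_inducedNorm_of_mem_spectrum hp (h n (by omega))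
    set y := newtonMatrix A lam n *ᵥ x with hy
    have e : newtonMatrix A lam (n + 1) *ᵥ x = A *ᵥ y - lam n • y := by
      rw [newtonMatrix_succ, ← Matrix.mulVec_mulVec, Matrix.sub_mulVec, Matrix.smul_mulVec,
        Matrix.one_mulVec]
    have h0 := inducedNorm_nonneg p A
    calc p (newtonMatrix A lam (n + 1) *ᵥ x) ≤ p (A *ᵥ y) + p (lam n • y) := by
          rw [e]; exact map_sub_le_add p _ _
      _ ≤ inducedNorm p A * p y + inducedNorm p A * p y := by
          rw [map_smul_eq_mul]
          exact add_le_add (le_inducedNorm_mul hp A y)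
            (mul_le_mul_of_nonneg_right hl (apply_nonneg p y))
      _ = 2 * inducedNorm p A * p y := by ring
      _ ≤ 2 * inducedNorm p A * ((2 * inducedNorm p A) ^ n * p x) := by gcongr
      _ = _ := by ring

/-- The sum telescopes on writing `z - A = (z - λ_n) - (A - λ_n)`. Once all roots are used, the
remainder vanishes and the sum is the resolvent. -/
theorem resolvent_mul_newtonSum (A : Matrix (Fin N) (Fin N) ℂ) (lam : ℕ → ℂ) {z : ℂ} (n : ℕ)
    (hz : ∀ l < n, z ≠ lam l) :
    (z • (1 : Matrix (Fin N) (Fin N) ℂ) - A) * ∑ j ∈ Finset.range n,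
        poleKernel ((Multiset.range (j + 1)).map lam) z • newtonMatrix A lam j =
      1 - poleKernel ((Multiset.range n).map lam) z • newtonMatrix A lam n := by
  induction n with
  | zero => simp [newtonMatrix_zero]
  | succ n ih =>
    have hne := sub_ne_zero.2 (hz n (by omega))
    rw [Finset.sum_range_succ, mul_add, ih fun l hl => hz l (by omega)]
    have e : poleKernel ((Multiset.range n).map lam) z =
        poleKernel ((Multiset.range (n + 1)).map lam) z * (z - lam n) := by
      rw [Multiset.range_succ, Multiset.map_cons, poleKernel_cons]
      field_simp
    rw [e, newtonMatrix_succ, mul_smul_comm]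
    have e2 : z • (1 : Matrix (Fin N) (Fin N) ℂ) - A = (z - lam n) • 1 - (A - lam n • 1) := by
      rw [sub_smul]; abel
    rw [e2, sub_mul, smul_mul_assoc, one_mul, smul_sub, mul_smul]
    abel

theorem cauchyMatrix_eq_newtonSum {A : Matrix (Fin N) (Fin N) ℂ} {lam : ℕ → ℂ} {n : ℕ}
    (h : A.charpoly.roots = (Multiset.range n).map lam) {Γ : Finset (ℂ × ℝ)}
    (hΓ : ∀ d ∈ Γ, 0 < d.2) (hlam : ∀ l < n, ∀ d ∈ Γ, lam l ∉ Metric.sphere d.1 d.2) {f : ℂ → ℂ}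
    (hf : Continuous f) :
    cauchyMatrix f A Γ = ∑ j ∈ Finset.range n,
      contourIntegral Γ (fun z => f z * poleKernel ((Multiset.range (j + 1)).map lam) z) •
        newtonMatrix A lam j := by
  ext a b
  have hinv : ∀ d ∈ Γ, ∀ z ∈ Metric.sphere d.1 d.2,
      f z * (z • (1 : Matrix (Fin N) (Fin N) ℂ) - A)⁻¹ a b = ∑ j ∈ Finset.range n,
        newtonMatrix A lam j a b *
          (f z * poleKernel ((Multiset.range (j + 1)).map lam) z) := by
    intro d hd z hz
    have h1 := resolvent_mul_newtonSum A lam (z := z) n (by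
      rintro l hl rfl
      exact hlam l hl d hd hz)
    rw [newtonMatrix_eq_zero h, smul_zero, sub_zero] at h1
    rw [Matrix.inv_eq_right_inv h1, Matrix.sum_apply, Finset.mul_sum]
    refine Finset.sum_congr rfl fun j _ => ?_
    rw [Matrix.smul_apply, smul_eq_mul]
    ring
  have hcont : ∀ j ∈ Finset.range n, ∀ d ∈ Γ,
      ContinuousOn (poleKernel ((Multiset.range (j + 1)).map lam)) (Metric.sphere d.1 d.2) := by
    intro j hj d hd
    refine continuousOn_poleKernel fun w hw => ?_
    obtain ⟨l, hl, rfl⟩ := Multiset.mem_map.1 hw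
    have := Multiset.mem_range.1 hl
    have := Finset.mem_range.1 hj
    exact hlam l (by omega) d hd
  calc cauchyMatrix f A Γ a b
      = contourIntegral Γ (fun z => f z * (z • (1 : Matrix (Fin N) (Fin N) ℂ) - A)⁻¹ a b) := rfl
    _ = _ := by
      rw [contourIntegral_congr hΓ hinv, contourIntegral_fun_sum _ hΓ]
      · rw [Matrix.sum_apply]
        refine Finset.sum_congr rfl fun j _ => ?_
        rw [contourIntegral_const_mul, Matrix.smul_apply, smul_eq_mul, mul_comm]
      · intro j hj d hd
        exact continuousOn_const.mul (hf.continuousOn.mul (hcont j hj d hd))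

theorem inducedNorm_cauchyMatrix_exp_le {k m : ℕ} {p : Seminorm ℂ (Fin N → ℂ)}
    (hp : ∀ x, p x = 0 → x = 0) {A : Matrix (Fin N) (Fin N) ℂ} {lam : ℕ → ℂ}
    (h : A.charpoly.roots = (Multiset.range (k + m)).map lam) {U K : Set ℂ} {Γ : Finset (ℂ × ℝ)}
    (hΓ : IsContourAround U K Γ) {γ g : ℝ} (hγ : 0 < γ) {σ : ℂ} (hσ : ‖σ‖ = 1)
    (hout : ∀ l < k, ∀ d ∈ Γ, lam l ∉ Metric.closedBall d.1 d.2)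
    (hin : ∀ l < m, lam (k + l) ∈ K) (hdist : ∀ i < k, ∀ j < m, γ ≤ ‖lam (k + j) - lam i‖)
    (hg : ∀ l < m, (σ * lam (k + l)).re ≤ -g) {t : ℝ} (ht : 0 ≤ t) :
    inducedNorm p (cauchyMatrix (fun z => Complex.exp (σ * z * t)) A Γ) ≤
      Real.exp (-g * t) * ∑ j ∈ Finset.range m, ∑ i ∈ Finset.range (j + 1),
        t ^ (j - i) / ((j - i).factorial : ℝ) * (binomCoeff k i : ℝ) *
          ((2 * inducedNorm p A) ^ (k + j) / γ ^ (k + i)) := by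
  have h0 := inducedNorm_nonneg p A
  refine inducedNorm_le (by positivity) fun x => ?_
  have hspec : ∀ l < k + m, lam l ∈ spectrum ℂ A := by
    intro l hl
    rw [Matrix.mem_spectrum_iff_isRoot_charpoly]
    refine Polynomial.isRoot_of_mem_roots ?_
    rw [h]
    exact Multiset.mem_map_of_mem _ (Multiset.mem_range.2 hl)
  have hsph : ∀ l < k + m, ∀ d ∈ Γ, lam l ∉ Metric.sphere d.1 d.2 := by
    intro l hl d hd
    rcases lt_or_ge l k with hlk | hlk
    · exact fun hs => hout l hlk d hd (Metric.sphere_subset_closedBall hs)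
    · obtain ⟨j, rfl⟩ := Nat.exists_eq_add_of_le hlk
      exact hΓ.notMem_sphere (hin j (by omega)) hd
  have hS : ∀ n ≤ k, ∀ w ∈ (Multiset.range n).map lam, ∀ d ∈ Γ,
      w ∉ Metric.closedBall d.1 d.2 := by
    intro n hn w hw
    obtain ⟨l, hl, rfl⟩ := Multiset.mem_map.1 hw
    exact hout l ((Multiset.mem_range.1 hl).trans_le hn)
  -- Only outer poles have appeared so far: with no inner pole the bound is an empty sum.
  have hc1 : ∀ n < k, expCoeff σ Γ ((Multiset.range (n + 1)).map lam) t = 0 := by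
    intro n hn
    have := norm_expCoeff_le hΓ hγ (g := g) hσ (hS (n + 1) hn) 0 (by simp) (by simp) (by simp) t ht
    simpa [taylorSum] using this
  have hc2 : ∀ j < m, ‖expCoeff σ Γ ((Multiset.range (k + j + 1)).map lam) t‖ ≤
      Real.exp (-g * t) * ∑ i ∈ Finset.range (j + 1), t ^ (j - i) / ((j - i).factorial : ℝ) *
        (binomCoeff k i / γ ^ (k + i)) := by
    intro j hj
    have hmem : ∀ w ∈ (Multiset.range (j + 1)).map (fun l => lam (k + l)),
        ∃ l < m, lam (k + l) = w := by
      intro w hw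
      obtain ⟨l, hl, rfl⟩ := Multiset.mem_map.1 hw
      have := Multiset.mem_range.1 hl
      exact ⟨l, by omega, rfl⟩
    have := norm_expCoeff_le hΓ hγ (g := g) hσ (hS k le_rfl)
      ((Multiset.range (j + 1)).map (fun l => lam (k + l)))
      (by
        intro w hw
        obtain ⟨l, hl, rfl⟩ := hmem w hw
        exact hin l hl)
      (by
        intro a ha w hw
        obtain ⟨l, hl, rfl⟩ := hmem w hw
        obtain ⟨i, hi, rfl⟩ := Multiset.mem_map.1 ha
        exact hdist i (Multiset.mem_range.1 hi) l hl)
      (by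
        intro w hw
        obtain ⟨l, hl, rfl⟩ := hmem w hw
        exact hg l hl) t ht
    rw [add_assoc, Multiset.range_add, Multiset.map_add, Multiset.map_map]
    simpa [taylorSum] using this
  rw [cauchyMatrix_eq_newtonSum h hΓ.radius_pos hsph (by fun_prop), Finset.sum_range_add,
    Finset.sum_eq_zero, zero_add, Matrix.sum_mulVec]
  · refine (Finset.le_sum_of_subadditive p (map_zero p).le (fun a b => map_add_le_add p a b)
      _ _).trans ?_
    rw [Finset.mul_sum, Finset.sum_mul]
    refine Finset.sum_le_sum fun j hj => ?_
    have hj' := Finset.mem_range.1 hj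
    rw [Matrix.smul_mulVec, map_smul_eq_mul]
    refine (mul_le_mul (hc2 j hj') (newtonMatrix_mulVec_le hp (k + j)
      (fun l hl => hspec l (by omega)) x) (apply_nonneg p _) (by positivity)).trans (le_of_eq ?_)
    rw [← mul_assoc, mul_assoc (Real.exp _), Finset.sum_mul]
    congr 2
    refine Finset.sum_congr rfl fun i _ => ?_
    ring
  · intro n hn
    have := hc1 n (Finset.mem_range.1 hn)
    rw [expCoeff] at this
    rw [this, zero_smul]


/-! ### Selecting a half-plane and concluding -/

theorem re_mul_re_pos_of_mem_closedBall {c z : ℂ} {r : ℝ} (h : Metric.closedBall c r ⊆ offAxis)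
    (hz : z ∈ Metric.closedBall c r) : 0 < z.re * c.re := by
  have hc : r < |c.re| := by
    by_contra! hr
    -- The foot of the perpendicular from the centre to the imaginary axis.
    have : c - (c.re : ℂ) ∈ Metric.closedBall c r := by
      rw [mem_closedBall_iff_norm, sub_sub_cancel_left, norm_neg, Complex.norm_real]
      exact hr
    exact h this (by simp)
  have h1 : |z.re - c.re| < |c.re| := by
    rw [← Complex.sub_re]
    exact (Complex.abs_re_le_norm _).trans_lt ((mem_closedBall_iff_norm.1 hz).trans_lt hc)
  rw [← sq_lt_sq] at h1
  nlinarith [sq_nonneg z.re]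

theorem cauchyMatrix_eq_smul_filter {N : ℕ} {f g : ℂ → ℂ} (A : Matrix (Fin N) (Fin N) ℂ)
    {Γ : Finset (ℂ × ℝ)} (hΓ : ∀ d ∈ Γ, 0 < d.2) (P : ℂ × ℝ → Prop) [DecidablePred P] (a : ℂ)
    (h1 : ∀ d ∈ Γ, P d → ∀ z ∈ Metric.sphere d.1 d.2, g z = a * f z)
    (h2 : ∀ d ∈ Γ, ¬ P d → ∀ z ∈ Metric.sphere d.1 d.2, g z = 0) :
    cauchyMatrix g A Γ = a • cauchyMatrix f A (Γ.filter P) := by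
  ext i j
  simp only [cauchyMatrix, Matrix.of_apply, Matrix.smul_apply, smul_eq_mul]
  rw [Finset.sum_filter, mul_left_comm, Finset.mul_sum _ _ a]
  refine congrArg _ (Finset.sum_congr rfl fun d hd => ?_)
  split_ifs with hP
  · rw [← circleIntegral.integral_const_mul]
    refine circleIntegral.integral_congr (hΓ d hd).le fun z hz => ?_
    simp only [h1 d hd hP z hz]
    ring
  · rw [mul_zero, circleIntegral.integral_congr (g := fun _ => 0) (hΓ d hd).le]
    · simp [circleIntegral]
    · intro z hz
      simp only [h2 d hd hP z hz, zero_mul]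

theorem greenSymbol_of_neg {r τ : ℝ} (hr : r = 1 ∨ r = -1) (hτ : 0 < τ) {z : ℂ}
    (hz : r * z.re < 0) : greenSymbol (r * τ) z = r * Complex.exp (r * z * τ) := by
  rcases hr with rfl | rfl
  · have h1 : ¬ τ < 0 := by linarith
    have h2 : z.re < 0 := by linarith
    simp [greenSymbol, expPlus, h1, h2]
  · have h2 : 0 < z.re := by linarith
    simp [greenSymbol, expMinus, hτ, h2]

theorem greenSymbol_of_pos {r τ : ℝ} (hr : r = 1 ∨ r = -1) (hτ : 0 < τ) {z : ℂ}
    (hz : 0 < r * z.re) : greenSymbol (r * τ) z = 0 := by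
  rcases hr with rfl | rfl
  · have h1 : ¬ τ < 0 := by linarith
    have h2 : ¬ z.re < 0 := by linarith
    simp [greenSymbol, expPlus, h1, h2]
  · have h2 : ¬ 0 < z.re := by linarith
    simp [greenSymbol, expMinus, hτ, h2]

/-- The sign `r` of the time treats both half-lines at once: the symbol survives where `r Re z < 0`,
and there it is `r e^{rzτ}`. Real parts alone separate the two groups of eigenvalues by `g + g'`. -/
theorem inducedNorm_cauchyMatrix_greenSymbol_le {N k m : ℕ} {p : Seminorm ℂ (Fin N → ℂ)}
    (hp : ∀ x, p x = 0 → x = 0) {A : Matrix (Fin N) (Fin N) ℂ} {lam : ℕ → ℂ}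
    (h : A.charpoly.roots = (Multiset.range (k + m)).map lam) {Γ : Finset (ℂ × ℝ)}
    (hΓ : IsContourAround offAxis (spectrum ℂ A) Γ) {r g g' : ℝ} (hr : r = 1 ∨ r = -1)
    (hg : 0 < g) (hg' : 0 < g') (hout : ∀ l < k, g' ≤ r * (lam l).re)
    (hin : ∀ l < m, r * (lam (k + l)).re ≤ -g) {τ : ℝ} (hτ : 0 < τ) :
    inducedNorm p (cauchyMatrix (greenSymbol (r * τ)) A Γ) ≤
      Real.exp (-g * τ) * ∑ j ∈ Finset.range m, ∑ i ∈ Finset.range (j + 1),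
        τ ^ (j - i) / ((j - i).factorial : ℝ) * (binomCoeff k i : ℝ) *
          ((2 * inducedNorm p A) ^ (k + j) / (g + g') ^ (k + i)) := by
  classical
  have hr2 : r * r = 1 := by rcases hr with rfl | rfl <;> norm_num
  have hrn : |r| = 1 := by rcases hr with rfl | rfl <;> norm_num
  have hsign : ∀ d ∈ Γ, ∀ z ∈ Metric.closedBall d.1 d.2, 0 < (r * z.re) * (r * d.1.re) := by
    intro d hd z hz
    have := re_mul_re_pos_of_mem_closedBall (hΓ.disc_subset d hd) hz
    calc 0 < z.re * d.1.re := this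
      _ = (r * r) * (z.re * d.1.re) := by rw [hr2, one_mul]
      _ = _ := by ring
  let P : ℂ × ℝ → Prop := fun d => r * d.1.re < 0
  have hΓ' : IsContourAround offAxis {z | z ∈ spectrum ℂ A ∧ r * z.re < 0} (Γ.filter P) := by
    refine ⟨fun d hd => hΓ.radius_pos d (Finset.mem_filter.1 hd).1,
      fun d hd => hΓ.disc_subset d (Finset.mem_filter.1 hd).1,
      fun d hd d' hd' => hΓ.disjoint_discs d (Finset.mem_filter.1 hd).1 d'
        (Finset.mem_filter.1 hd').1, fun z hz => ?_⟩
    obtain ⟨d, hd, hzd⟩ := hΓ.surrounds z hz.1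
    refine ⟨d, Finset.mem_filter.2 ⟨hd, ?_⟩, hzd⟩
    exact neg_of_mul_pos_right (hsign d hd z (Metric.ball_subset_closedBall hzd)) hz.2.le
  have hC : cauchyMatrix (greenSymbol (r * τ)) A Γ = (r : ℂ) •
      cauchyMatrix (fun z => Complex.exp (r * z * τ)) A (Γ.filter P) := by
    refine cauchyMatrix_eq_smul_filter A hΓ.radius_pos P r ?_ ?_
    · intro d hd hP z hz
      refine greenSymbol_of_neg hr hτ ?_
      have := hsign d hd z (Metric.sphere_subset_closedBall hz)
      exact neg_of_mul_pos_left this hP.le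
    · intro d hd hP z hz
      refine greenSymbol_of_pos hr hτ ?_
      have := hsign d hd z (Metric.sphere_subset_closedBall hz)
      exact pos_of_mul_pos_left this (not_lt.1 hP)
  have hnorm : ∀ B : Matrix (Fin N) (Fin N) ℂ, inducedNorm p ((r : ℂ) • B) = inducedNorm p B := by
    intro B
    rcases hr with rfl | rfl
    · simp
    · simpa using inducedNorm_neg p B
  rw [hC, hnorm]
  refine inducedNorm_cauchyMatrix_exp_le hp h hΓ' (add_pos hg hg') (by simpa using hrn)
    ?_ ?_ ?_ ?_ hτ.le
  · intro l hl d hd hmem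
    obtain ⟨hd, hP⟩ := Finset.mem_filter.1 hd
    have h1 := hsign d hd _ hmem
    have h2 : r * (lam l).re < 0 := neg_of_mul_pos_left h1 hP.le
    linarith [hout l hl]
  · intro l hl
    refine ⟨?_, by linarith [hin l hl]⟩
    rw [Matrix.mem_spectrum_iff_isRoot_charpoly]
    refine Polynomial.isRoot_of_mem_roots ?_
    rw [h]
    exact Multiset.mem_map_of_mem _ (Multiset.mem_range.2 (by omega))
  · intro i hi j hj
    calc g + g' ≤ -(r * (lam (k + j) - lam i).re) := by
          rw [Complex.sub_re]; linarith [hout i hi, hin j hj]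
      _ ≤ |r * (lam (k + j) - lam i).re| := neg_le_abs _
      _ ≤ _ := by rw [abs_mul, hrn, one_mul]; exact Complex.abs_re_le_norm _
  · intro l hl
    rw [Complex.re_ofReal_mul]
    exact hin l hl

theorem exists_seq_of_fin {α : Type*} [Inhabited α] {k m : ℕ} (u : Fin k → α) (v : Fin m → α) :
    ∃ lam : ℕ → α, (Finset.univ : Finset (Fin k)).val.map u +
        (Finset.univ : Finset (Fin m)).val.map v = (Multiset.range (k + m)).map lam ∧
      (∀ l (hl : l < k), lam l = u ⟨l, hl⟩) ∧ ∀ l (hl : l < m), lam (k + l) = v ⟨l, hl⟩ := by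
  have hrange : ∀ n : ℕ, Multiset.range n = (Finset.univ : Finset (Fin n)).val.map Fin.val := by
    intro n
    rw [Fin.univ_val_map, List.ofFn_eq_map, List.map_coe_finRange_eq_range]
    rfl
  -- Values from index `k + m` on are never used.
  refine ⟨fun n => if h : n < k then u ⟨n, h⟩ else if h : n - k < m then v ⟨n - k, h⟩ else default,
    ?_, ?_, ?_⟩
  · rw [Multiset.range_add, Multiset.map_add, hrange k, hrange m]
    simp only [Multiset.map_map]
    congr 1 <;> exact Multiset.map_congr rfl fun x _ => by simp
  · intro l hl
    simp [hl]
  · intro l hl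
    simp [hl]

end GreenEstimate

end

theorem theorem4p1 (N k m : ℕ)
    (p : Seminorm ℂ (Fin N → ℂ)) (hp : ∀ x : Fin N → ℂ, p x = 0 → x = 0)
    (A : Matrix (Fin N) (Fin N) ℂ)
    (hA : spectrum ℂ A ⊆ GreenEstimate.offAxis)
    (μ : Fin k → ℂ) (ν : Fin m → ℂ)
    (hroots : A.charpoly.roots =
      (Finset.univ : Finset (Fin k)).val.map μ + (Finset.univ : Finset (Fin m)).val.map ν)
    (γplus γminus : ℝ) (hγplus : 0 < γplus) (hγminus : 0 < γminus)
    (hμ : ∀ i, γplus ≤ (μ i).re) (hν : ∀ j, (ν j).re ≤ -γminus) :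
    (∀ t : ℝ, 0 < t →
      GreenEstimate.inducedNorm p (GreenEstimate.greenFunction A hA t) ≤
        Real.exp (-γminus * t) *
          ∑ j ∈ Finset.range m, ∑ i ∈ Finset.range (j + 1),
            t ^ (j - i) / ((j - i).factorial : ℝ) * (GreenEstimate.binomCoeff k i : ℝ) *
              ((2 * GreenEstimate.inducedNorm p A) ^ (k + j) / (γminus + γplus) ^ (k + i))) ∧
    (∀ t : ℝ, t < 0 →
      GreenEstimate.inducedNorm p (GreenEstimate.greenFunction A hA t) ≤
        Real.exp (γplus * t) *
          ∑ j ∈ Finset.range k, ∑ i ∈ Finset.range (j + 1),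
            |t| ^ (j - i) / ((j - i).factorial : ℝ) * (GreenEstimate.binomCoeff m i : ℝ) *
              ((2 * GreenEstimate.inducedNorm p A) ^ (m + j) / (γminus + γplus) ^ (m + i))) := by
  have hΓ := (GreenEstimate.exists_contour GreenEstimate.offAxis (spectrum ℂ A)
    GreenEstimate.isOpen_offAxis (Matrix.finite_spectrum A) hA).choose_spec
  constructor
  · intro t ht
    obtain ⟨lam, hlam, h1, h2⟩ := GreenEstimate.exists_seq_of_fin μ ν
    have := GreenEstimate.inducedNorm_cauchyMatrix_greenSymbol_le hp (hroots.trans hlam) hΓ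
      (r := 1) (Or.inl rfl) hγminus hγplus (fun l hl => by rw [h1 l hl, one_mul]; exact hμ _)
      (fun l hl => by rw [h2 l hl, one_mul]; exact hν _) ht
    rw [one_mul] at this
    exact this
  · intro t ht
    -- For negative time the right half-plane is enclosed, so the `ν` come first and the roles of
    -- `k, γplus` and `m, γminus` are exchanged.
    obtain ⟨lam, hlam, h1, h2⟩ := GreenEstimate.exists_seq_of_fin ν μ
    have := GreenEstimate.inducedNorm_cauchyMatrix_greenSymbol_le hp
      ((hroots.trans (add_comm _ _)).trans hlam) hΓ
      (r := -1) (Or.inr rfl) hγplus hγminus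
      (fun l hl => by rw [h1 l hl]; linarith [hν ⟨l, hl⟩])
      (fun l hl => by rw [h2 l hl]; linarith [hμ ⟨l, hl⟩]) (neg_pos.2 ht)
    rw [neg_mul_neg, neg_mul_neg, one_mul, add_comm γplus, ← abs_of_neg ht] at this
    exact this
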